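/- Let $t\in\mathbb{R}$. There is a constant $C>0$, depending only on $t$, such that the following holds. Let $G$ be a connected simple graph on $N$ vertices that is not a tree, i.e. with at least $N$ edges (in particular, any connected graph with more edges than vertices); call vertices $j,k$ connected if $j=k$ or $jk$ is an edge. Let $H\in\mathbb{C}^{N\times N}$ be Hermitian with all eigenvalues of absolute value at most $\pi$ and $H_{jk}=0$ whenever $j,k$ are not connected, so that $U=e^{-iHt}$ is an $H$-local unitary. Then for every $\delta>0$ and every basis state $z$ of the internal register $\mathbb{C}^N\otimes\mathbb{C}^2$ there are unitaries $W_1,\dots,W_m$ on $\mathbb{C}^N\otimes(\mathbb{C}^N\otimes\mathbb{C}^2)$ (position register $\otimes$ internal register), each of them $C$-local, with $$m\le C\max\Big(\frac1{\sqrt\delta},\sqrt N\Big)\qquad\text{and}\qquad \big\| J^\dagger\, W_1W_2\cdots W_m\, J-e^{-iHt}\big\|\le\delta ,$$ where $J|j\rangle=|j,z\rangle$ and $\|\cdot\|$ is the spectral norm. Here a unitary $W$ is $C$-local if the basis states $|j,y\rangle$ ($j$ a vertex, $y$ an internal basis state) can be partitioned into sets such that $W$ has no nonzero entry between basis states of distinct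 sets, and each set contains only basis states of one vertex or of two adjacent vertices. -/

import Mathlib

/-!
# Local matrices on a graph

`V` is the vertex set of a simple graph `G`, and every vertex counts as connected to itself.
A finite set `ι` labels the basis states, and `loc : ι → V` gives the vertex at which a basis
state sits: `loc = id` for states `|j⟩` without internal degrees of freedom, and `loc = Prod.fst`
for states `|j, z⟩` with an internal state `z`.
-/

namespace GraphLocal

/-- `v` and `w` are connected: equal, or joined by an edge. -/
def Connected {V : Type*} (G : SimpleGraph V) (v w : V) : Prop :=
  v = w ∨ G.Adj v w

/-- A matrix is `Z`-local if it has no entry between basis states at unconnected vertices. -/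
def IsZLocal {V ι : Type*} (G : SimpleGraph V) (loc : ι → V) (A : Matrix ι ι ℂ) : Prop :=
  ∀ i j, ¬ Connected G (loc i) (loc j) → A i j = 0

/-- A matrix is `C`-local if the basis states can be partitioned (into the classes of an
equivalence relation) so that it has no entry between distinct parts, and each part contains
basis states of a single vertex or of two adjacent vertices only. -/
def IsCLocal {V ι : Type*} (G : SimpleGraph V) (loc : ι → V) (A : Matrix ι ι ℂ) : Prop :=
  ∃ P : Setoid ι,
    (∀ i j, ¬ P i j → A i j = 0) ∧
    ∀ S ∈ P.classes, ∃ v w, Connected G v w ∧ ∀ i ∈ S, loc i = v ∨ loc i = w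

/-- `U` is `H`-local with time `t`: `U = e^{-iHt}` for a `Z`-local Hermitian matrix `H` whose
eigenvalues have absolute value at most `π`. -/
def IsHLocal {V ι : Type*} [Fintype ι] [DecidableEq ι] (G : SimpleGraph V) (loc : ι → V)
    (t : ℝ) (U : Matrix ι ι ℂ) : Prop :=
  ∃ (H : Matrix ι ι ℂ) (hH : H.IsHermitian),
    (∀ i, |hH.eigenvalues i| ≤ Real.pi) ∧ IsZLocal G loc H ∧
      U = NormedSpace.exp ((-(Complex.I * (t : ℂ))) • H)

/-- The spectral norm of a square matrix: the operator norm for the Euclidean norm. -/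
noncomputable def opNorm {ι : Type*} [Fintype ι] [DecidableEq ι] (A : Matrix ι ι ℂ) : ℝ :=
  ‖Matrix.toEuclideanCLM (n := ι) (𝕜 := ℂ) A‖

/-- The block `J† A J` of a matrix `A` on `ℂ^V ⊗ ℂ^Z`, where `J |j⟩ = |j, z⟩` for a fixed internal
state `z`: its `(j, k)` entry is `⟨j, z| A |k, z⟩`. -/
def block {V Z : Type*} (z : Z) (A : Matrix (V × Z) (V × Z) ℂ) : Matrix V V ℂ :=
  Matrix.of fun j k => A (j, z) (k, z)

end GraphLocal

/-! The evolution is simulated by a quantum walk with `n = 4k` steps for the small matrix `A =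
-(t/n) H`. Coin states `ψ j` attached to the vertices give an isometry `T`, and the flip `S` along
edges satisfies `T† S T = A` (`coinMap_coinState_compression`). With the reflection `R = 2TT† - 1`,
the powers of `W = S R` compress to Chebyshev polynomials of `A`: an eigenvalue `x = cos θ` becomes
`cos nθ` (`walk_compression`).

This is only the real part of a phase. Conjugating by `(1 + iS)/√2` adds an imaginary part, giving
`cos nθ - i sin nθ sin θ` (`halfTurn_walk_compression`). Put `φ = arcsin x`, so that `θ = π/2 - φ`.
Since `4 ∣ n`, the value equals `cos nφ + i sin nφ cos φ`. It differs from `e^{inφ}` by `O(x²)`, and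
`e^{inφ}` differs from `e^{inx}` by `O(n|x|³)`. As `x = O(1/n)`, the total error is `O(1/n²)`, so
`n` of order `1/√δ` suffices.

The term `√N` comes from normalising the coin states, which is possible once `‖A‖` is at most a
constant over `√N`. Locality holds because `S` exchanges basis states in pairs along edges, while
`R` and the preparation of the coin states act inside single vertices. -/

namespace GraphLocal

open Matrix

/-! ### Walk operators built from an isometry and a reflection -/

section Walk

variable {ι V : Type*} [Fintype ι] [DecidableEq ι] [Fintype V] [DecidableEq V]

/-- The reflection about the range of the isometry `T`. -/
def rangeReflection (T : Matrix ι V ℂ) : Matrix ι ι ℂ := (2 : ℂ) • (T * Tᴴ) - 1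

omit [Fintype ι] [DecidableEq V] in
lemma rangeReflection_conjTranspose (T : Matrix ι V ℂ) :
    (rangeReflection T)ᴴ = rangeReflection T := by
  simp [rangeReflection, conjTranspose_sub, conjTranspose_smul, conjTranspose_mul]

lemma rangeReflection_mul {T : Matrix ι V ℂ} (hT : Tᴴ * T = 1) : rangeReflection T * T = T := by
  rw [rangeReflection, Matrix.sub_mul, Matrix.smul_mul, Matrix.mul_assoc, hT, Matrix.mul_one,
    Matrix.one_mul, two_smul]
  abel

lemma conjTranspose_mul_rangeReflection {T : Matrix ι V ℂ} (hT : Tᴴ * T = 1) :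
    Tᴴ * rangeReflection T = Tᴴ := by
  have h := congrArg conjTranspose (rangeReflection_mul hT)
  rwa [conjTranspose_mul, rangeReflection_conjTranspose] at h

lemma rangeReflection_mul_self {T : Matrix ι V ℂ} (hT : Tᴴ * T = 1) :
    rangeReflection T * rangeReflection T = 1 := by
  conv_lhs => enter [1]; rw [rangeReflection]
  rw [Matrix.sub_mul, Matrix.smul_mul, Matrix.mul_assoc, conjTranspose_mul_rangeReflection hT,
    Matrix.one_mul, rangeReflection]
  abel

/-- The three-term recurrence of the walk generated by `S` and the reflection about `T`. -/
lemma walk_recurrence {T : Matrix ι V ℂ} {S : Matrix ι ι ℂ} (hT : Tᴴ * T = 1) (hS : S * S = 1)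
    (n : ℕ) :
    (S * rangeReflection T) ^ (n + 2) * T =
      (2 : ℂ) • ((S * rangeReflection T) ^ (n + 1) * T * (Tᴴ * S * T)) -
        (S * rangeReflection T) ^ n * T := by
  have h1 : S * rangeReflection T * T = S * T := by
    rw [Matrix.mul_assoc, rangeReflection_mul hT]
  -- This is where the recurrence arises: `R` sends `ST` to `2T(T†ST) - ST`, and `S² = 1` turns the
  -- last term into `T`.
  have h2 : S * rangeReflection T * (S * T) = (2 : ℂ) • (S * T * (Tᴴ * S * T)) - T := by
    have : rangeReflection T * (S * T) = (2 : ℂ) • (T * (Tᴴ * S * T)) - S * T := by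
      rw [rangeReflection, Matrix.sub_mul, Matrix.smul_mul, Matrix.one_mul]
      simp only [Matrix.mul_assoc]
    rw [Matrix.mul_assoc, this, Matrix.mul_sub, Matrix.mul_smul, ← Matrix.mul_assoc S S, hS,
      Matrix.one_mul, ← Matrix.mul_assoc S T]
  have h3 : (S * rangeReflection T) ^ (n + 1) * T = (S * rangeReflection T) ^ n * (S * T) := by
    rw [pow_succ, Matrix.mul_assoc, h1]
  have h4 : (S * rangeReflection T) ^ (n + 2) * T =
      (S * rangeReflection T) ^ n * (S * rangeReflection T * (S * T)) := by
    rw [pow_succ, Matrix.mul_assoc, h1, pow_succ, Matrix.mul_assoc]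
  rw [h3, Matrix.mul_assoc _ (S * T), h4, h2, Matrix.mul_sub, Matrix.mul_smul]

/-- The compression of the `n`-th power of the walk is the `n`-th Chebyshev polynomial of the
compression of `S`. -/
lemma walk_compression {T : Matrix ι V ℂ} {S : Matrix ι ι ℂ} (hT : Tᴴ * T = 1) (hS : S * S = 1)
    {Q : Matrix V V ℂ} (hQ : Qᴴ * Q = 1) {θ : V → ℝ}
    (hQS : Tᴴ * S * T = Q * diagonal (fun i => (Real.cos (θ i) : ℂ)) * Qᴴ) (n : ℕ) :
    Tᴴ * ((S * rangeReflection T) ^ n * T) =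
      Q * diagonal (fun i => (Real.cos (n * θ i) : ℂ)) * Qᴴ := by
  have hQ' : Q * Qᴴ = 1 := mul_eq_one_comm.mp hQ
  induction n using Nat.twoStepInduction with
  | zero => simp [hT, hQ']
  | one =>
    rw [pow_one, Matrix.mul_assoc S, rangeReflection_mul hT, ← Matrix.mul_assoc, hQS]
    simp
  | more n h0 h1 =>
    rw [walk_recurrence hT hS, Matrix.mul_sub, Matrix.mul_smul, ← Matrix.mul_assoc, h0, h1, hQS]
    have : Q * diagonal (fun i => (Real.cos (((n + 1 : ℕ) : ℝ) * θ i) : ℂ)) * Qᴴ *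
        (Q * diagonal (fun i => (Real.cos (θ i) : ℂ)) * Qᴴ) =
        Q * diagonal (fun i => (Real.cos (((n + 1 : ℕ) : ℝ) * θ i) : ℂ) *
          (Real.cos (θ i) : ℂ)) * Qᴴ := by
      rw [← diagonal_mul_diagonal]
      simp only [Matrix.mul_assoc]
      rw [← Matrix.mul_assoc Qᴴ Q, hQ, Matrix.one_mul]
    rw [this, ← Matrix.smul_mul, ← Matrix.mul_smul, ← Matrix.sub_mul, ← Matrix.mul_sub,
      ← diagonal_smul, diagonal_sub]
    congr 3
    funext i
    have e : Real.cos (((n + 2 : ℕ) : ℝ) * θ i) =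
        2 * (Real.cos (((n + 1 : ℕ) : ℝ) * θ i) * Real.cos (θ i)) - Real.cos (n * θ i) := by
      have a : ((n + 2 : ℕ) : ℝ) * θ i = ((n + 1 : ℕ) : ℝ) * θ i + θ i := by push_cast; ring
      have b : (n : ℝ) * θ i = ((n + 1 : ℕ) : ℝ) * θ i - θ i := by push_cast; ring
      rw [a, b, Real.cos_add, Real.cos_sub]
      ring
    rw [e]
    push_cast
    simp

/-- The unitary `(1 + iS)/√2` for a Hermitian unitary `S`. -/
noncomputable def halfTurn (S : Matrix ι ι ℂ) : Matrix ι ι ℂ :=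
  ((Real.sqrt 2 : ℂ)⁻¹) • (1 + Complex.I • S)

omit [Fintype ι] in
lemma halfTurn_conjTranspose {S : Matrix ι ι ℂ} (hS : Sᴴ = S) :
    (halfTurn S)ᴴ = ((Real.sqrt 2 : ℂ)⁻¹) • (1 - Complex.I • S) := by
  simp [halfTurn, conjTranspose_smul, hS, sub_eq_add_neg]

lemma sqrt_two_inv_mul_self : (Real.sqrt 2 : ℂ)⁻¹ * (Real.sqrt 2 : ℂ)⁻¹ = 1 / 2 := by
  rw [← mul_inv, ← Complex.ofReal_mul, Real.mul_self_sqrt (by norm_num)]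
  norm_num

lemma halfTurn_mem_unitary {S : Matrix ι ι ℂ} (hS : Sᴴ = S) (hSS : S * S = 1) :
    halfTurn S ∈ unitaryGroup ι ℂ := by
  rw [mem_unitaryGroup_iff', star_eq_conjTranspose, halfTurn_conjTranspose hS, halfTurn,
    Matrix.smul_mul, Matrix.mul_smul, smul_smul, sqrt_two_inv_mul_self]
  have : (1 - Complex.I • S) * (1 + Complex.I • S) = (2 : ℂ) • (1 : Matrix ι ι ℂ) := by
    rw [Matrix.sub_mul, Matrix.one_mul, Matrix.mul_add, Matrix.mul_one, Matrix.smul_mul,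
      Matrix.mul_smul, hSS, smul_smul, Complex.I_mul_I, two_smul, neg_one_smul]
    abel
  rw [this, smul_smul]
  norm_num

/-- The compression of the walk conjugated by `(1 + iS)/√2`. -/
lemma halfTurn_walk_compression {T : Matrix ι V ℂ} {S : Matrix ι ι ℂ} (hT : Tᴴ * T = 1)
    (hSH : Sᴴ = S) (hS : S * S = 1) {Q : Matrix V V ℂ} (hQ : Qᴴ * Q = 1) {θ : V → ℝ}
    (hQS : Tᴴ * S * T = Q * diagonal (fun i => (Real.cos (θ i) : ℂ)) * Qᴴ) {n : ℕ} (hn : 0 < n) :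
    Tᴴ * ((halfTurn S)ᴴ * (S * rangeReflection T) ^ n * halfTurn S) * T =
      Q * diagonal (fun i => (Real.cos (n * θ i) : ℂ) -
        Complex.I * (Real.sin (n * θ i) * Real.sin (θ i) : ℝ)) * Qᴴ := by
  obtain ⟨m, rfl⟩ : ∃ m, n = m + 1 := ⟨n - 1, by omega⟩
  set R := rangeReflection T with hR
  set W := S * R with hW
  -- At the right end `S` raises the power of `W` by one; at the left end it lowers it by one, which
  -- needs `n > 0`. The cross terms thus give `cos (n+1)θ - cos (n-1)θ = -2 sin nθ sin θ`.
  have hWT : S * T = W * T := by rw [hW, Matrix.mul_assoc, hR, rangeReflection_mul hT]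
  have hTS : Tᴴ * S * W = Tᴴ := by
    rw [hW, Matrix.mul_assoc, ← Matrix.mul_assoc S S, hS, Matrix.one_mul, hR,
      conjTranspose_mul_rangeReflection hT]
  have c := walk_compression hT hS hQ hQS
  have e1 : Tᴴ * S * W ^ (m + 1) * T = Tᴴ * (W ^ m * T) := by
    rw [pow_succ', ← Matrix.mul_assoc, hTS, Matrix.mul_assoc]
  have e2 : Tᴴ * W ^ (m + 1) * S * T = Tᴴ * (W ^ (m + 2) * T) := by
    rw [Matrix.mul_assoc _ S T, hWT, pow_succ W (m + 1)]
    simp only [Matrix.mul_assoc]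
  have e3 : Tᴴ * S * W ^ (m + 1) * S * T = Tᴴ * (W ^ (m + 1) * T) := by
    rw [Matrix.mul_assoc _ S T, hWT, pow_succ' W m, ← Matrix.mul_assoc (Tᴴ * S), hTS,
      ← pow_succ', pow_succ]
    simp only [Matrix.mul_assoc]
  have e4 : Tᴴ * W ^ (m + 1) * T = Tᴴ * (W ^ (m + 1) * T) := Matrix.mul_assoc _ _ _
  have expand : Tᴴ * ((halfTurn S)ᴴ * W ^ (m + 1) * halfTurn S) * T =
      (1 / 2 : ℂ) • (Tᴴ * W ^ (m + 1) * T + Complex.I • (Tᴴ * W ^ (m + 1) * S * T) -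
        Complex.I • (Tᴴ * S * W ^ (m + 1) * T) + Tᴴ * S * W ^ (m + 1) * S * T) := by
    rw [halfTurn_conjTranspose hSH, halfTurn]
    simp only [Matrix.smul_mul, Matrix.mul_smul, smul_smul, sqrt_two_inv_mul_self]
    congr 1
    simp only [Matrix.sub_mul, Matrix.mul_sub, Matrix.add_mul, Matrix.mul_add, Matrix.one_mul,
      Matrix.mul_one, Matrix.smul_mul, Matrix.mul_smul, smul_sub, smul_smul, Complex.I_mul_I,
      Matrix.mul_assoc]
    simp
    abel
  rw [expand, e1, e2, e3, e4, c, c, c]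
  have lin (a b c : V → ℂ) : (1 / 2 : ℂ) • (Q * diagonal a * Qᴴ +
      Complex.I • (Q * diagonal b * Qᴴ) - Complex.I • (Q * diagonal c * Qᴴ) +
      Q * diagonal a * Qᴴ) =
      Q * diagonal (fun i => 1 / 2 * (a i + Complex.I * b i - Complex.I * c i + a i)) * Qᴴ := by
    have : diagonal (fun i => 1 / 2 * (a i + Complex.I * b i - Complex.I * c i + a i)) =
        (1 / 2 : ℂ) • (diagonal a + Complex.I • diagonal b - Complex.I • diagonal c +
          diagonal a) := by
      simp only [← diagonal_smul, diagonal_sub, diagonal_add]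
      rfl
    rw [this]
    simp only [Matrix.mul_add, Matrix.add_mul, Matrix.mul_sub, Matrix.sub_mul, Matrix.mul_smul,
      Matrix.smul_mul]
  rw [lin]
  congr 3
  funext i
  have a : ((m + 2 : ℕ) : ℝ) * θ i = ((m + 1 : ℕ) : ℝ) * θ i + θ i := by push_cast; ring
  have b : (m : ℝ) * θ i = ((m + 1 : ℕ) : ℝ) * θ i - θ i := by push_cast; ring
  rw [a, b, Real.cos_add, Real.cos_sub]
  push_cast
  ring

end Walk

/-! ### Approximating an exponential by the walk's eigenvalues -/

lemma abs_arcsin_le {x : ℝ} (hx : |x| ≤ 1) : |Real.arcsin x| ≤ 2 * |x| := by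
  have h1 := (abs_le.mp hx)
  have key : ∀ y : ℝ, 0 ≤ y → y ≤ 1 → Real.arcsin y ≤ 2 * y := by
    intro y h0 h1
    have hs := Real.mul_le_sin (Real.arcsin_nonneg.mpr h0) (Real.arcsin_le_pi_div_two y)
    rw [Real.sin_arcsin (by linarith) h1] at hs
    have hp := Real.pi_le_four
    have hpos := Real.pi_pos
    have : Real.arcsin y ≤ Real.pi / 2 * y := by
      rw [div_mul_eq_mul_div, div_le_iff₀ hpos] at hs
      linarith
    nlinarith
  rcases le_total 0 x with h | h
  · rw [abs_of_nonneg h, abs_of_nonneg (Real.arcsin_nonneg.mpr h)]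
    exact key x h h1.2
  · rw [abs_of_nonpos h, abs_of_nonpos (Real.arcsin_nonpos.mpr h), ← Real.arcsin_neg]
    exact key (-x) (by linarith) (by linarith)

lemma abs_sub_sin_le {x : ℝ} (hx : |x| ≤ 1) : |x - Real.sin x| ≤ |x| ^ 3 / 4 := by
  have key : ∀ y : ℝ, 0 ≤ y → y ≤ 1 → |y - Real.sin y| ≤ y ^ 3 / 4 := by
    intro y h0 h1
    rcases h0.eq_or_lt with rfl | h0
    · simp
    · rw [abs_of_nonneg (by linarith [Real.sin_le h0.le])]
      linarith [Real.sin_gt_sub_cube h0, pow_pos h0 3]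
  rcases le_total 0 x with h | h
  · rw [abs_of_nonneg h] at hx ⊢
    exact key x h hx
  · rw [abs_of_nonpos h] at hx ⊢
    have := key (-x) (by linarith) hx
    rw [Real.sin_neg] at this
    rwa [← abs_neg, show -(x - Real.sin x) = -x - -Real.sin x by ring]

/-- The cubic term is the phase error `n |φ - sin φ|` with `φ = arcsin x`; the quadratic one is the
amplitude error `1 - cos φ`. -/
lemma norm_walk_eigenvalue_sub_exp_le {k : ℕ} {x : ℝ} (hx : |x| ≤ 1 / 2) :
    ‖((Real.cos ((4 * k : ℕ) * Real.arccos x) : ℂ) -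
        Complex.I * (Real.sin ((4 * k : ℕ) * Real.arccos x) * Real.sin (Real.arccos x) : ℝ)) -
      Complex.exp (((4 * k : ℕ) * x : ℝ) * Complex.I)‖ ≤
      2 * (4 * k : ℕ) * |x| ^ 3 + 2 * |x| ^ 2 := by
  set φ := Real.arcsin x with hφ
  have h1 : |φ| ≤ 2 * |x| := abs_arcsin_le (by linarith)
  have hx1 := abs_le.mp hx
  have hsin : Real.sin φ = x := Real.sin_arcsin (by linarith) (by linarith)
  have h2 : |φ - x| ≤ 2 * |x| ^ 3 := by
    have := abs_sub_sin_le (x := φ) (by linarith)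
    rw [hsin] at this
    have h3 : |φ| ^ 3 ≤ (2 * |x|) ^ 3 := by gcongr
    nlinarith
  have hθ : Real.arccos x = Real.pi / 2 - φ := rfl
  -- With a multiple of four steps the offset `nπ/2` is a full number of turns and drops out.
  have harg : ((4 * k : ℕ) : ℝ) * Real.arccos x = k * (2 * Real.pi) - (4 * k : ℕ) * φ := by
    rw [hθ]; push_cast; ring
  set y : ℝ := (4 * k : ℕ) * φ with hy
  have hcos : Real.cos ((4 * k : ℕ) * Real.arccos x) = Real.cos y := by
    rw [harg, Real.cos_nat_mul_two_pi_sub]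
  have hsn : Real.sin ((4 * k : ℕ) * Real.arccos x) = -Real.sin y := by
    rw [harg, Real.sin_nat_mul_two_pi_sub]
  have hsθ : Real.sin (Real.arccos x) = Real.cos φ := by
    rw [hθ, Real.sin_pi_div_two_sub]
  rw [hcos, hsn, hsθ]
  have split : ((Real.cos y : ℂ) - Complex.I * (-Real.sin y * Real.cos φ : ℝ)) -
      Complex.exp (((4 * k : ℕ) * x : ℝ) * Complex.I) =
      (Complex.exp (y * Complex.I) - Complex.exp (((4 * k : ℕ) * x : ℝ) * Complex.I)) +
        ((-(Real.sin y * (1 - Real.cos φ)) : ℝ) : ℂ) * Complex.I := by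
    rw [Complex.exp_mul_I y, ← Complex.ofReal_cos, ← Complex.ofReal_sin]
    push_cast
    ring
  have b1 : ‖Complex.exp (y * Complex.I) - Complex.exp (((4 * k : ℕ) * x : ℝ) * Complex.I)‖ ≤
      (4 * k : ℕ) * |φ - x| := by
    have e : Complex.exp (y * Complex.I) - Complex.exp (((4 * k : ℕ) * x : ℝ) * Complex.I) =
        Complex.exp (((4 * k : ℕ) * x : ℝ) * Complex.I) *
          (Complex.exp (Complex.I * (y - (4 * k : ℕ) * x : ℝ)) - 1) := by
      rw [mul_sub, ← Complex.exp_add, mul_one]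
      congr 2
      push_cast
      ring
    rw [e, norm_mul, Complex.norm_exp_ofReal_mul_I, one_mul]
    refine (Real.norm_exp_I_mul_ofReal_sub_one_le).trans ?_
    rw [hy, ← mul_sub, Real.norm_eq_abs, abs_mul, Nat.abs_cast]
  have b2 : ‖((-(Real.sin y * (1 - Real.cos φ)) : ℝ) : ℂ) * Complex.I‖ ≤ 2 * |x| ^ 2 := by
    rw [norm_mul, Complex.norm_I, mul_one, Complex.norm_real, Real.norm_eq_abs, abs_neg, abs_mul,
      abs_of_nonneg (sub_nonneg.mpr (Real.cos_le_one φ))]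
    have c1 := Real.abs_sin_le_one y
    have c2 := Real.one_sub_sq_div_two_le_cos (x := φ)
    have c3 : φ ^ 2 ≤ (2 * |x|) ^ 2 := by rw [← sq_abs φ]; gcongr
    calc |Real.sin y| * (1 - Real.cos φ) ≤ 1 * (1 - Real.cos φ) := by
          gcongr
          linarith [Real.cos_le_one φ]
      _ ≤ 2 * |x| ^ 2 := by linarith
  rw [split]
  refine (norm_add_le _ _).trans (add_le_add (b1.trans ?_) b2)
  calc ((4 * k : ℕ) : ℝ) * |φ - x| ≤ (4 * k : ℕ) * (2 * |x| ^ 3) := by gcongr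
    _ = _ := by ring

/-! ### Local matrices and the swap of a graph -/

section Local

lemma isCLocal_of_blockDiagonal {V ι : Type*} (G : SimpleGraph V) {loc : ι → V}
    {A : Matrix ι ι ℂ} (hA : ∀ i j, loc i ≠ loc j → A i j = 0) : IsCLocal G loc A := by
  refine ⟨Setoid.ker loc, fun i j h => hA i j h, ?_⟩
  rintro _ ⟨y, rfl⟩
  exact ⟨loc y, loc y, Or.inl rfl, fun i hi => Or.inl hi⟩

/-- The parts are the orbits `{i, σ i}`. This covers the flip and also its linear combinations with
the identity. -/
lemma isCLocal_of_involutive {V ι : Type*} {G : SimpleGraph V} {loc : ι → V} {σ : ι → ι}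
    (hσ : Function.Involutive σ) (hc : ∀ i, Connected G (loc i) (loc (σ i)))
    {A : Matrix ι ι ℂ} (hA : ∀ i j, i ≠ j → σ i ≠ j → A i j = 0) : IsCLocal G loc A := by
  refine ⟨⟨fun i j => i = j ∨ σ i = j, fun i => Or.inl rfl, ?_, ?_⟩, ?_, ?_⟩
  · rintro i j (rfl | rfl)
    · exact Or.inl rfl
    · exact Or.inr (hσ i)
  · rintro i j k (rfl | rfl) (rfl | rfl)
    · exact Or.inl rfl
    · exact Or.inr rfl
    · exact Or.inr rfl
    · exact Or.inl (hσ i).symm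
  · intro i j h
    exact hA i j (fun e => h (Or.inl e)) (fun e => h (Or.inr e))
  · rintro _ ⟨y, rfl⟩
    refine ⟨loc y, loc (σ y), hc y, ?_⟩
    rintro i (rfl | h)
    · exact Or.inl rfl
    · exact Or.inr (by rw [← h, hσ i])

variable {V : Type*} [DecidableEq V]

open Classical in
/-- The involution exchanging `|j, k, b⟩` with `|k, j, 1 - b⟩` along the edges `jk` of `G`, and
`|j, k, b⟩` with `|j, k, 1 - b⟩` otherwise. -/
noncomputable def edgeFlip (G : SimpleGraph V) (x : V × (V × Fin 2)) : V × (V × Fin 2) :=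
  if G.Adj x.1 x.2.1 then (x.2.1, (x.1, x.2.2 + 1)) else (x.1, (x.2.1, x.2.2 + 1))

omit [DecidableEq V] in
lemma edgeFlip_of_adj {G : SimpleGraph V} {j l : V} (h : G.Adj j l) (b : Fin 2) :
    edgeFlip G (j, (l, b)) = (l, (j, b + 1)) := by
  simp [edgeFlip, h]

omit [DecidableEq V] in
lemma edgeFlip_of_not_adj {G : SimpleGraph V} {j l : V} (h : ¬ G.Adj j l) (b : Fin 2) :
    edgeFlip G (j, (l, b)) = (j, (l, b + 1)) := by
  simp [edgeFlip, h]

omit [DecidableEq V] in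
lemma edgeFlip_involutive (G : SimpleGraph V) : Function.Involutive (edgeFlip G) := by
  rintro ⟨j, l, b⟩
  have hb : b + 1 + 1 = b := by revert b; decide
  by_cases h : G.Adj j l
  · rw [edgeFlip_of_adj h, edgeFlip_of_adj h.symm, hb]
  · rw [edgeFlip_of_not_adj h, edgeFlip_of_not_adj h, hb]

omit [DecidableEq V] in
lemma connected_edgeFlip (G : SimpleGraph V) (x : V × (V × Fin 2)) :
    Connected G x.1 (edgeFlip G x).1 := by
  obtain ⟨j, l, b⟩ := x
  by_cases h : G.Adj j l
  · rw [edgeFlip_of_adj h]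
    exact Or.inr h
  · rw [edgeFlip_of_not_adj h]
    exact Or.inl rfl

/-- The permutation matrix of `edgeFlip`. -/
noncomputable def edgeSwap (G : SimpleGraph V) :
    Matrix (V × (V × Fin 2)) (V × (V × Fin 2)) ℂ :=
  Matrix.of fun x y => if edgeFlip G x = y then 1 else 0

lemma edgeSwap_conjTranspose (G : SimpleGraph V) : (edgeSwap G)ᴴ = edgeSwap G := by
  ext x y
  have : edgeFlip G y = x ↔ edgeFlip G x = y :=
    ⟨fun h => by rw [← h, edgeFlip_involutive], fun h => by rw [← h, edgeFlip_involutive]⟩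
  simp [edgeSwap, conjTranspose_apply, this, apply_ite]

variable [Fintype V]

lemma edgeSwap_mul_apply {κ : Type*} (G : SimpleGraph V)
    (A : Matrix (V × (V × Fin 2)) κ ℂ) (x : V × (V × Fin 2)) (k : κ) :
    (edgeSwap G * A) x k = A (edgeFlip G x) k := by
  simp [edgeSwap, mul_apply]

lemma edgeSwap_mul_self (G : SimpleGraph V) : edgeSwap G * edgeSwap G = 1 := by
  ext x y
  rw [edgeSwap_mul_apply, edgeSwap, of_apply, edgeFlip_involutive, one_apply]

/-! ### Coin states -/

/-- The map `|j⟩ ↦ |j⟩ ⊗ ψ j`. -/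
def coinMap {Y : Type*} (ψ : V → Y → ℂ) : Matrix (V × Y) V ℂ :=
  Matrix.of fun x k => if x.1 = k then ψ k x.2 else 0

lemma coinMap_isometry {Y : Type*} [Fintype Y] {ψ : V → Y → ℂ}
    (hψ : ∀ j, ∑ y, ‖ψ j y‖ ^ 2 = 1) : (coinMap ψ)ᴴ * coinMap ψ = 1 := by
  ext j k
  rw [mul_apply, Fintype.sum_prod_type, one_apply]
  simp only [conjTranspose_apply, coinMap, of_apply]
  by_cases h : j = k
  · subst h
    rw [Finset.sum_eq_single j (by intro l _ hl; simp [hl]) (by simp), if_pos rfl,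
      ← Complex.ofReal_one, ← hψ j]
    push_cast
    refine Finset.sum_congr rfl fun y _ => ?_
    simp [Complex.conj_mul']
  · rw [if_neg h]
    refine Finset.sum_eq_zero fun l _ => Finset.sum_eq_zero fun y _ => ?_
    by_cases hl : l = j
    · simp [hl, h]
    · simp [hl]

/-- Coin states whose walk compresses to `A`. The slack in the normalisation is absorbed in the
two components at `j` itself. -/
noncomputable def coinState (A : Matrix V V ℂ) (a : ℝ) (j : V) (y : V × Fin 2) : ℂ :=
  if y.1 = j then
    (((Real.sqrt (1 - ∑ k ∈ Finset.univ.erase j, (a ^ 2 + ‖A k j‖ ^ 2 / (4 * a ^ 2)) +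
        (A j j).re) +
      (-1) ^ (y.2 : ℕ) * Real.sqrt (1 - ∑ k ∈ Finset.univ.erase j,
        (a ^ 2 + ‖A k j‖ ^ 2 / (4 * a ^ 2)) - (A j j).re)) / 2 : ℝ) : ℂ)
  else if y.2 = 0 then (a : ℂ) else A y.1 j / (2 * a)

variable {A : Matrix V V ℂ} {a : ℝ}

/-- The components at `j` are `(p ± q)/2` with `p² = 1 - s + A j j` and `q² = 1 - s - A j j`; their
squares add up to `(p² + q²)/2 = 1 - s`, exactly the missing mass. -/
lemma sum_norm_coinState_sq (ha : 0 < a)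
    (h : ∀ j, ∑ k ∈ Finset.univ.erase j, (a ^ 2 + ‖A k j‖ ^ 2 / (4 * a ^ 2)) +
      |(A j j).re| ≤ 1) (j : V) : ∑ y, ‖coinState A a j y‖ ^ 2 = 1 := by
  have hj := h j
  rw [Fintype.sum_prod_type, ← Finset.add_sum_erase _ _ (Finset.mem_univ j)]
  set s := ∑ k ∈ Finset.univ.erase j, (a ^ 2 + ‖A k j‖ ^ 2 / (4 * a ^ 2)) with hs
  have hr := abs_le.mp (show |(A j j).re| ≤ 1 - s by linarith)
  have e1 : ∑ b, ‖coinState A a j (j, b)‖ ^ 2 = 1 - s := by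
    have p := Real.sq_sqrt (show 0 ≤ 1 - s + (A j j).re by linarith)
    have q := Real.sq_sqrt (show 0 ≤ 1 - s - (A j j).re by linarith)
    rw [Fin.sum_univ_two]
    simp only [coinState, if_true, Complex.norm_real, Real.norm_eq_abs, sq_abs, ← hs]
    simp only [Fin.val_zero, Fin.val_one, pow_zero, pow_one]
    nlinarith
  have e2 : ∑ k ∈ Finset.univ.erase j, ∑ b, ‖coinState A a j (k, b)‖ ^ 2 = s := by
    refine Finset.sum_congr rfl fun k hk => ?_
    have hk' : k ≠ j := Finset.ne_of_mem_erase hk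
    rw [Fin.sum_univ_two]
    simp [coinState, hk', abs_of_pos ha, div_pow, mul_pow]
    ring
  rw [e1, e2]
  ring

lemma coinMap_coinState_compression {G : SimpleGraph V} (hA : A.IsHermitian)
    (hG : IsZLocal G id A) (ha : 0 < a)
    (h : ∀ j, ∑ k ∈ Finset.univ.erase j, (a ^ 2 + ‖A k j‖ ^ 2 / (4 * a ^ 2)) +
      |(A j j).re| ≤ 1) :
    (coinMap (coinState A a))ᴴ * edgeSwap G * coinMap (coinState A a) = A := by
  have ha' : (a : ℂ) ≠ 0 := by exact_mod_cast ha.ne'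
  have hherm : ∀ i j, star (A i j) = A j i := fun i j => hA.apply j i
  -- The flip of the qubit always pairs an amplitude `a` with an amplitude `A/(2a)`, and each of the
  -- two pairings contributes half of the entry.
  have cross : ∀ j k, k ≠ j → star (coinState A a j (k, 0)) * coinState A a k (j, 1) = A j k / 2 ∧
      star (coinState A a j (k, 1)) * coinState A a k (j, 0) = A j k / 2 := by
    intro j k hk
    have h2 := hherm k j
    simp only [RCLike.star_def] at h2
    constructor <;> simp [coinState, hk, hk.symm, h2] <;> field_simp
  -- Along a non-edge the flip stays at `j` and pairs `a` with this zero, so the uniform amplitudes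
  -- leave no spurious diagonal term.
  have stay : ∀ j l, l ≠ j → ¬ G.Adj j l →
      coinState A a j (l, 1) = 0 := by
    intro j l hl hadj
    have : A l j = 0 := hG l j fun c => c.elim hl fun c => hadj c.symm
    simp [coinState, hl, this]
  -- Twice the product of `(p + q)/2` and `(p - q)/2` is `(p² - q²)/2 = A j j`.
  have diag : ∀ j, star (coinState A a j (j, 0)) * coinState A a j (j, 1) +
      star (coinState A a j (j, 1)) * coinState A a j (j, 0) = A j j := by
    intro j
    have hj := h j
    set s := ∑ k ∈ Finset.univ.erase j, (a ^ 2 + ‖A k j‖ ^ 2 / (4 * a ^ 2)) with hs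
    have hr := abs_le.mp (show |(A j j).re| ≤ 1 - s by linarith)
    have p := Real.sq_sqrt (show 0 ≤ 1 - s + (A j j).re by linarith)
    have q := Real.sq_sqrt (show 0 ≤ 1 - s - (A j j).re by linarith)
    have hre : ((A j j).re : ℂ) = A j j := Complex.conj_eq_iff_re.mp (hherm j j)
    simp only [coinState, if_true, RCLike.star_def, Complex.conj_ofReal, ← hs]
    rw [← hre, ← Complex.ofReal_mul, ← Complex.ofReal_mul, ← Complex.ofReal_add]
    congr 1
    simp only [Fin.val_zero, Fin.val_one, pow_zero, pow_one, Complex.ofReal_re]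
    nlinarith
  ext j k
  rw [Matrix.mul_assoc, mul_apply, Fintype.sum_prod_type,
    Finset.sum_eq_single j (by intro l _ hl; simp [coinMap, hl]) (by simp),
    Fintype.sum_prod_type]
  simp only [edgeSwap_mul_apply, conjTranspose_apply, Fin.sum_univ_two]
  rw [Finset.sum_eq_single k]
  · by_cases hjk : G.Adj j k
    · rw [edgeFlip_of_adj hjk, edgeFlip_of_adj hjk]
      have c := cross j k hjk.ne'
      simp only [coinMap, of_apply, if_true]
      rw [show (0 : Fin 2) + 1 = 1 from rfl, show (1 : Fin 2) + 1 = 0 from rfl, c.1, c.2]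
      ring
    · rw [edgeFlip_of_not_adj hjk, edgeFlip_of_not_adj hjk]
      by_cases e : j = k
      · subst e
        simp only [coinMap, of_apply, if_true]
        exact diag j
      · rw [hG j k fun c => c.elim e hjk]
        simp [coinMap, e]
  · intro l _ hl
    by_cases hjl : G.Adj j l
    · rw [edgeFlip_of_adj hjl, edgeFlip_of_adj hjl]
      simp [coinMap, hl]
    · rw [edgeFlip_of_not_adj hjl, edgeFlip_of_not_adj hjl]
      by_cases e : j = k
      · subst e
        have c := stay j l hl hjl
        simp [coinMap, c]
      · simp [coinMap, e]
  · simp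

/-- A unitary acting inside each vertex that prepares the coin states from `|z⟩`. -/
lemma exists_unitary_preparing {Y : Type*} [Fintype Y] [DecidableEq Y] (z : Y) {ψ : V → Y → ℂ}
    (hψ : ∀ j, ∑ y, ‖ψ j y‖ ^ 2 = 1) :
    ∃ F ∈ unitaryGroup (V × Y) ℂ, (∀ x x', x.1 ≠ x'.1 → F x x' = 0) ∧
      ∀ x k, F x (k, z) = coinMap ψ x k := by
  have ex : ∀ j, ∃ M ∈ unitaryGroup Y ℂ, ∀ y, M y z = ψ j y := by
    intro j
    -- Extend the unit vector `ψ j` to an orthonormal basis with `ψ j` at index `z`; the basis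
    -- vectors are the columns of the unitary.
    have hv : Orthonormal ℂ (({z} : Set Y).domRestrict
        fun _ => (WithLp.toLp 2 (ψ j) : EuclideanSpace ℂ Y)) := by
      constructor
      · intro i
        simp only [Set.domRestrict_apply, EuclideanSpace.norm_eq]
        rw [hψ j, Real.sqrt_one]
      · intro i i' hi
        exact absurd (Subsingleton.elim i i') hi
    obtain ⟨b, hb⟩ := hv.exists_orthonormalBasis_extension_of_card_eq (by simp)
    refine ⟨_, (EuclideanSpace.basisFun Y ℂ).toMatrix_orthonormalBasis_mem_unitary b, ?_⟩
    intro y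
    have := hb z rfl
    simp [Module.Basis.toMatrix_apply, this]
  choose M hM hMz using ex
  refine ⟨Matrix.of fun x x' => if x.1 = x'.1 then M x.1 x.2 x'.2 else 0, ?_, ?_, ?_⟩
  · rw [mem_unitaryGroup_iff]
    ext ⟨j, y⟩ ⟨k, y'⟩
    rw [mul_apply, Fintype.sum_prod_type]
    simp only [star_apply, of_apply]
    rw [Finset.sum_eq_single j (by intro l _ hl; simp [hl.symm]) (by simp)]
    by_cases h : j = k
    · subst h
      have := congrFun (congrFun (mem_unitaryGroup_iff.mp (hM j)) y) y'
      rw [mul_apply] at this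
      simpa [one_apply, star_apply] using this
    · have h' : ¬ k = j := fun e => h e.symm
      simp [one_apply, h, h']
  · intro x x' hx
    simp [hx]
  · intro x k
    by_cases h : x.1 = k
    · simp [coinMap, h, hMz]
    · simp [coinMap, h]

end Local

/-! ### Spectral bounds -/

section Norm

variable {V : Type*} [Fintype V] [DecidableEq V]

open scoped Matrix.Norms.L2Operator in
lemma opNorm_conj_diagonal_le {Q : Matrix V V ℂ} (hQ : Q ∈ unitaryGroup V ℂ) {v : V → ℂ} {c : ℝ}
    (hc : 0 ≤ c) (hv : ∀ i, ‖v i‖ ≤ c) : opNorm (Q * diagonal v * Qᴴ) ≤ c := by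
  rw [opNorm, l2_opNorm_toEuclideanCLM, ← star_eq_conjTranspose,
    CStarRing.norm_mul_mem_unitary _ (Unitary.star_mem hQ), CStarRing.norm_mem_unitary_mul _ hQ,
    l2_opNorm_diagonal]
  exact (pi_norm_le_iff_of_nonneg hc).mpr hv

open scoped Matrix.Norms.L2Operator in
lemma sum_norm_sq_col_le (A : Matrix V V ℂ) (j : V) : ∑ k, ‖A k j‖ ^ 2 ≤ opNorm A ^ 2 := by
  have h := l2_opNorm_mulVec A (EuclideanSpace.single j 1)
  rw [PiLp.norm_single, norm_one, mul_one, ← l2_opNorm_toEuclideanCLM,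
    EuclideanSpace.norm_eq] at h
  have h3 := Real.sq_sqrt (Finset.sum_nonneg fun k (_ : k ∈ Finset.univ) => sq_nonneg ‖A k j‖)
  have h4 : √(∑ k, ‖A k j‖ ^ 2) ≤ opNorm A := by
    simpa [opNorm, mulVec_single_one] using h
  rw [← h3]
  gcongr

/-- The spectral theorem and the exponential of a Hermitian matrix in terms of it. -/
lemma exists_diagonalization {H : Matrix V V ℂ} (hH : H.IsHermitian) (c : ℂ) :
    ∃ Q ∈ unitaryGroup V ℂ, H = Q * diagonal (fun i => (hH.eigenvalues i : ℂ)) * Qᴴ ∧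
      NormedSpace.exp (c • H) =
        Q * diagonal (fun i => Complex.exp (c * hH.eigenvalues i)) * Qᴴ := by
  have hQ := hH.eigenvectorUnitary.2
  have hs : H = (hH.eigenvectorUnitary : Matrix V V ℂ) *
      diagonal (fun i => (hH.eigenvalues i : ℂ)) * (hH.eigenvectorUnitary : Matrix V V ℂ)ᴴ := by
    conv_lhs => rw [hH.spectral_theorem]
    rfl
  refine ⟨_, hQ, hs, ?_⟩
  set Q := (hH.eigenvectorUnitary : Matrix V V ℂ)
  have hinv : Qᴴ = Q⁻¹ := (inv_eq_right_inv (mem_unitaryGroup_iff.mp hQ)).symm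
  have hu : IsUnit Q := ⟨⟨Q, Qᴴ, mem_unitaryGroup_iff.mp hQ, mem_unitaryGroup_iff'.mp hQ⟩, rfl⟩
  conv_lhs => rw [hs]
  rw [← Matrix.smul_mul, ← Matrix.mul_smul, hinv, exp_conj _ _ hu, ← diagonal_smul, exp_diagonal]
  congr 3
  funext i
  rw [Pi.coe_exp, Complex.exp_eq_exp_ℂ]
  simp

end Norm

/-! ### Simulating the evolution -/

section Simulation

variable {V : Type*} [Fintype V] [DecidableEq V]

lemma rangeReflection_coinMap_apply {Y : Type*} [DecidableEq Y] (ψ : V → Y → ℂ)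
    {x x' : V × Y} (h : x.1 ≠ x'.1) : rangeReflection (coinMap ψ) x x' = 0 := by
  have hx : x ≠ x' := fun e => h (congrArg Prod.fst e)
  have : (coinMap ψ * (coinMap ψ)ᴴ) x x' = 0 := by
    rw [mul_apply]
    refine Finset.sum_eq_zero fun k _ => ?_
    by_cases hk : x.1 = k
    · have : x'.1 ≠ k := fun e => h (hk.trans e.symm)
      simp [coinMap, this]
    · simp [coinMap, hk]
  simp [rangeReflection, this, hx]

omit [Fintype V] in
lemma halfTurn_edgeSwap_isCLocal (G : SimpleGraph V) :
    IsCLocal G Prod.fst (halfTurn (edgeSwap G)) :=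
  isCLocal_of_involutive (edgeFlip_involutive G) (connected_edgeFlip G) fun i j hij hs => by
    simp [halfTurn, edgeSwap, hij, hs]

omit [Fintype V] in
lemma halfTurn_edgeSwap_conjTranspose_isCLocal (G : SimpleGraph V) :
    IsCLocal G Prod.fst (halfTurn (edgeSwap G))ᴴ :=
  isCLocal_of_involutive (edgeFlip_involutive G) (connected_edgeFlip G) fun i j hij hs => by
    rw [halfTurn_conjTranspose (edgeSwap_conjTranspose G)]
    simp [edgeSwap, hij, hs]

/-- A product of `2n + 4` local unitaries which compresses to the walk of a normalised `Z`-local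
Hermitian matrix. -/
lemma exists_local_walk {G : SimpleGraph V} {A : Matrix V V ℂ} (hA : A.IsHermitian)
    (hG : IsZLocal G id A) {a : ℝ} (ha : 0 < a)
    (h : ∀ j, ∑ k ∈ Finset.univ.erase j, (a ^ 2 + ‖A k j‖ ^ 2 / (4 * a ^ 2)) +
      |(A j j).re| ≤ 1)
    {Q : Matrix V V ℂ} (hQ : Qᴴ * Q = 1) {θ : V → ℝ}
    (hAQ : A = Q * diagonal (fun i => (Real.cos (θ i) : ℂ)) * Qᴴ) {n : ℕ} (hn : 0 < n)
    (z : V × Fin 2) :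
    ∃ L : List (Matrix (V × (V × Fin 2)) (V × (V × Fin 2)) ℂ),
      L.length = 2 * n + 4 ∧
      (∀ W ∈ L, W ∈ unitaryGroup (V × (V × Fin 2)) ℂ ∧ IsCLocal G Prod.fst W) ∧
      block z L.prod = Q * diagonal (fun i => (Real.cos (n * θ i) : ℂ) -
        Complex.I * (Real.sin (n * θ i) * Real.sin (θ i) : ℝ)) * Qᴴ := by
  have hψ := sum_norm_coinState_sq ha h
  obtain ⟨F, hFu, hF0, hFz⟩ := exists_unitary_preparing z hψ
  set T := coinMap (coinState A a) with hTdef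
  have hT : Tᴴ * T = 1 := coinMap_isometry hψ
  set S := edgeSwap G with hSdef
  have hSH : Sᴴ = S := edgeSwap_conjTranspose G
  have hS : S * S = 1 := edgeSwap_mul_self G
  have hTST : Tᴴ * S * T = A := coinMap_coinState_compression hA hG ha h
  have hP := halfTurn_mem_unitary hSH hS
  have key := halfTurn_walk_compression hT hSH hS hQ (hTST.trans hAQ) hn
  have hSloc : IsCLocal G Prod.fst S :=
    isCLocal_of_involutive (edgeFlip_involutive G) (connected_edgeFlip G) fun i j _ hs => by
      simp [hSdef, edgeSwap, hs]
  have hSu : S ∈ unitaryGroup (V × (V × Fin 2)) ℂ := by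
    rw [mem_unitaryGroup_iff, star_eq_conjTranspose, hSH, hS]
  have hRloc : IsCLocal G Prod.fst (rangeReflection T) :=
    isCLocal_of_blockDiagonal G fun x x' hx => rangeReflection_coinMap_apply _ hx
  have hRu : rangeReflection T ∈ unitaryGroup (V × (V × Fin 2)) ℂ := by
    rw [mem_unitaryGroup_iff, star_eq_conjTranspose, rangeReflection_conjTranspose,
      rangeReflection_mul_self hT]
  -- `F` agrees with `T` on the states `|k, z⟩`, so taking the block at `z` of a product conjugated
  -- by `F` is compressing by `T`.
  refine ⟨[Fᴴ, (halfTurn S)ᴴ] ++ (List.replicate n [S, rangeReflection T]).flatten ++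
    [halfTurn S, F], ?_, ?_, ?_⟩
  · simp
    ring
  · intro W hW
    simp only [List.mem_append, List.mem_flatten, List.mem_replicate, List.mem_cons,
      List.not_mem_nil, or_false] at hW
    rcases hW with ((rfl | rfl) | ⟨l, ⟨_, rfl⟩, hW⟩) | rfl | rfl
    · exact ⟨Unitary.star_mem hFu, isCLocal_of_blockDiagonal G fun x x' hx => by
        rw [conjTranspose_apply, hF0 _ _ hx.symm, star_zero]⟩
    · exact ⟨Unitary.star_mem hP, halfTurn_edgeSwap_conjTranspose_isCLocal G⟩
    · simp only [List.mem_cons, List.not_mem_nil, or_false] at hW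
      rcases hW with rfl | rfl
      · exact ⟨hSu, hSloc⟩
      · exact ⟨hRu, hRloc⟩
    · exact ⟨hP, halfTurn_edgeSwap_isCLocal G⟩
    · exact ⟨hFu, isCLocal_of_blockDiagonal G hF0⟩
  · rw [← key]
    have hprod : ([Fᴴ, (halfTurn S)ᴴ] ++ (List.replicate n [S, rangeReflection T]).flatten ++
        [halfTurn S, F]).prod =
        Fᴴ * ((halfTurn S)ᴴ * (S * rangeReflection T) ^ n * halfTurn S) * F := by
      simp [List.prod_flatten, mul_assoc]
    rw [hprod]
    ext j k
    simp only [block, of_apply, Matrix.mul_apply, conjTranspose_apply, hFz]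

/-- Simulating the evolution with a walk of `4 * k` steps. -/
lemma exists_local_simulation [Nonempty V] {G : SimpleGraph V} {H : Matrix V V ℂ}
    (hH : H.IsHermitian) (hev : ∀ i, |hH.eigenvalues i| ≤ Real.pi) (hG : IsZLocal G id H)
    {t κ : ℝ} (hκ : κ = Real.pi * |t| + 1) {k : ℕ}
    (hk : κ * Real.sqrt (Fintype.card V) ≤ k) (z : V × Fin 2) :
    ∃ L : List (Matrix (V × (V × Fin 2)) (V × (V × Fin 2)) ℂ),
      L.length = 8 * k + 4 ∧
      (∀ W ∈ L, W ∈ unitaryGroup (V × (V × Fin 2)) ℂ ∧ IsCLocal G Prod.fst W) ∧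
      opNorm (block z L.prod - NormedSpace.exp ((-(Complex.I * (t : ℂ))) • H)) ≤
        κ ^ 3 / (4 * (k : ℝ) ^ 2) := by
  set N : ℝ := (Fintype.card V : ℝ) with hN
  have hN1 : 1 ≤ N := by
    rw [hN]
    exact_mod_cast Fintype.card_pos
  have hκ1 : 1 ≤ κ := by
    have := mul_nonneg Real.pi_pos.le (abs_nonneg t)
    linarith
  have hsN : 1 ≤ Real.sqrt N := Real.one_le_sqrt.mpr hN1
  have hsq : Real.sqrt N ^ 2 = N := Real.sq_sqrt (by linarith)
  have hk1 : 1 ≤ (k : ℝ) := (one_le_mul_of_one_le_of_one_le hκ1 hsN).trans hk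
  have hk0 : 0 < k := by exact_mod_cast lt_of_lt_of_le one_pos hk1
  obtain ⟨Q, hQ, hHQ, hexp⟩ := exists_diagonalization hH (-(Complex.I * (t : ℂ)))
  have hQQ : Qᴴ * Q = 1 := mem_unitaryGroup_iff'.mp hQ
  set n : ℕ := 4 * k with hn
  have hnk : (n : ℝ) = 4 * k := by rw [hn]; push_cast; ring
  have hn0 : (0 : ℝ) < n := by rw [hnk]; linarith
  set x : V → ℝ := fun i => -(t / n) * hH.eigenvalues i with hx
  -- `κ / n` bounds the spectrum of `A`; this is the step where `k ≥ κ√N` enters.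
  have hμ : κ / n ≤ 1 / (4 * Real.sqrt N) := by
    rw [div_le_div_iff₀ hn0 (by positivity), hnk]
    linarith
  have hμ4 : κ / n ≤ 1 / 4 := hμ.trans (by
    rw [div_le_div_iff₀ (by positivity) (by norm_num)]
    linarith)
  have hμ0 : 0 ≤ κ / n := by positivity
  have hxb : ∀ i, |x i| ≤ κ / n := by
    intro i
    rw [hx]
    simp only [abs_mul, abs_neg, abs_div, Nat.abs_cast]
    rw [div_mul_eq_mul_div]
    gcongr
    nlinarith [hev i, abs_nonneg t]
  set A : Matrix V V ℂ := ((-(t / n) : ℝ) : ℂ) • H with hAdef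
  have hA : A.IsHermitian := by
    rw [hAdef, IsHermitian, conjTranspose_smul, hH.eq, RCLike.star_def, Complex.conj_ofReal]
  have hAG : IsZLocal G id A := fun i j hij => by
    rw [hAdef, Matrix.smul_apply, hG i j hij, smul_zero]
  have hAx : A = Q * diagonal (fun i => (x i : ℂ)) * Qᴴ := by
    rw [hAdef]
    conv_lhs => rw [hHQ]
    rw [← Matrix.smul_mul, ← Matrix.mul_smul, ← diagonal_smul]
    congr 3
    funext i
    simp [hx]
  have hAQ : A = Q * diagonal (fun i => (Real.cos (Real.arccos (x i)) : ℂ)) * Qᴴ := by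
    rw [hAx]
    congr 3
    funext i
    have := abs_le.mp (hxb i)
    rw [Real.cos_arccos (by linarith) (by linarith)]
  have hAnorm : opNorm A ≤ κ / n := by
    rw [hAx]
    refine opNorm_conj_diagonal_le hQ hμ0 fun i => ?_
    rw [Complex.norm_real]
    exact hxb i
  have hcol : ∀ j, ∑ k, ‖A k j‖ ^ 2 ≤ (κ / n) ^ 2 := fun j =>
    (sum_norm_sq_col_le A j).trans (pow_le_pow_left₀ (norm_nonneg _) hAnorm 2)
  -- With `a² = 1/(2N)` the uniform amplitudes use at most half of the mass, the matrix entries at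
  -- most `(N/2)(κ/n)² ≤ 1/32`, and the diagonal term at most `1/4`.
  have ha : 0 < Real.sqrt (1 / (2 * N)) := Real.sqrt_pos.mpr (by positivity)
  have ha2 : Real.sqrt (1 / (2 * N)) ^ 2 = 1 / (2 * N) := Real.sq_sqrt (by positivity)
  have hμN : N * (κ / n) ^ 2 ≤ 1 / 16 := by
    calc N * (κ / n) ^ 2 ≤ N * (1 / (4 * Real.sqrt N)) ^ 2 := by gcongr
      _ = 1 / 16 := by
        rw [div_pow, mul_pow, hsq]
        field_simp
        norm_num
  have hnorm : ∀ j, ∑ k ∈ Finset.univ.erase j,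
      (Real.sqrt (1 / (2 * N)) ^ 2 + ‖A k j‖ ^ 2 / (4 * Real.sqrt (1 / (2 * N)) ^ 2)) +
      |(A j j).re| ≤ 1 := by
    intro j
    rw [ha2]
    have h1 : ∑ k ∈ Finset.univ.erase j, (1 / (2 * N) + ‖A k j‖ ^ 2 / (4 * (1 / (2 * N)))) ≤
        ∑ k, (1 / (2 * N) + ‖A k j‖ ^ 2 / (4 * (1 / (2 * N)))) :=
      Finset.sum_le_sum_of_subset_of_nonneg (Finset.erase_subset _ _) fun _ _ _ => by positivity
    have h2 : ∑ k, (1 / (2 * N) + ‖A k j‖ ^ 2 / (4 * (1 / (2 * N)))) =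
        1 / 2 + N / 2 * ∑ k, ‖A k j‖ ^ 2 := by
      rw [Finset.sum_add_distrib, Finset.mul_sum, Finset.sum_const, Finset.card_univ,
        nsmul_eq_mul, ← hN]
      congr 1
      · field_simp
      · refine Finset.sum_congr rfl fun k _ => ?_
        field_simp
        norm_num
    have h3 : |(A j j).re| ≤ κ / n := by
      refine (Complex.abs_re_le_norm _).trans (abs_le_of_sq_le_sq' ?_ hμ0).2
      exact (Finset.single_le_sum (f := fun k => ‖A k j‖ ^ 2) (fun _ _ => sq_nonneg _)
        (Finset.mem_univ j)).trans (hcol j)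
    have h4 : N / 2 * ∑ k, ‖A k j‖ ^ 2 ≤ N / 2 * (κ / n) ^ 2 := by
      gcongr
      exact hcol j
    linarith
  obtain ⟨L, hlen, hloc, hblock⟩ :=
    exists_local_walk hA hAG ha hnorm hQQ hAQ (n := n) (by omega) z
  refine ⟨L, by rw [hlen, hn]; ring, hloc, ?_⟩
  rw [hblock, hexp, ← Matrix.sub_mul, ← Matrix.mul_sub, diagonal_sub]
  refine opNorm_conj_diagonal_le hQ (by positivity) fun i => ?_
  have e := norm_walk_eigenvalue_sub_exp_le (k := k) (x := x i) (by linarith [hxb i])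
  have earg : (((4 * k : ℕ) * x i : ℝ) : ℂ) * Complex.I =
      -(Complex.I * (t : ℂ)) * hH.eigenvalues i := by
    have : ((4 * k : ℕ) : ℝ) * x i = -t * hH.eigenvalues i := by
      rw [hx, ← hn]
      field_simp
    rw [this]
    push_cast
    ring
  rw [earg] at e
  refine e.trans ?_
  calc 2 * ((4 * k : ℕ) : ℝ) * |x i| ^ 3 + 2 * |x i| ^ 2 ≤
      2 * (n : ℝ) * (κ / n) ^ 3 + 2 * (κ / n) ^ 2 := by
        rw [← hn]
        have := hxb i
        gcongr
    _ = (2 * κ ^ 3 + 2 * κ ^ 2) / (n : ℝ) ^ 2 := by field_simp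
    _ ≤ 4 * κ ^ 3 / (n : ℝ) ^ 2 := by
        gcongr
        nlinarith [mul_le_mul_of_nonneg_left hκ1 (sq_nonneg κ)]
    _ = κ ^ 3 / (4 * (k : ℝ) ^ 2) := by
        rw [hnk]
        field_simp

end Simulation

end GraphLocal

/-! ### Choice of the number of steps -/

theorem theorem4 (t : ℝ) :
    ∃ C : ℝ, 0 < C ∧
      ∀ (N : ℕ) (G : SimpleGraph (Fin N)), G.Connected → ¬ G.IsTree →
      ∀ U : Matrix (Fin N) (Fin N) ℂ, GraphLocal.IsHLocal G id t U →
      ∀ δ : ℝ, 0 < δ →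
      -- the internal register consists of a copy of the vertex set and one qubit
      ∀ z : Fin N × Fin 2,
      ∃ L : List (Matrix (Fin N × (Fin N × Fin 2)) (Fin N × (Fin N × Fin 2)) ℂ),
        (L.length : ℝ) ≤ C * max (1 / Real.sqrt δ) (Real.sqrt (N : ℝ)) ∧
        (∀ W ∈ L, W ∈ Matrix.unitaryGroup (Fin N × (Fin N × Fin 2)) ℂ ∧
          GraphLocal.IsCLocal G Prod.fst W) ∧
        GraphLocal.opNorm (GraphLocal.block z L.prod - U) ≤ δ := by
  set κ : ℝ := Real.pi * |t| + 1 with hκ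
  have hκ1 : 1 ≤ κ := by
    have := mul_nonneg Real.pi_pos.le (abs_nonneg t)
    linarith
  -- Below, `k ≤ 2κ²M` and `1 ≤ κ²M`, so the length `8k + 4` is at most `20κ²M`.
  refine ⟨24 * κ ^ 2, by positivity, ?_⟩
  rintro N G hconn - U ⟨H, hH, hev, hG, rfl⟩ δ hδ z
  have hne : Nonempty (Fin N) := hconn.nonempty
  have hN : 1 ≤ Real.sqrt (N : ℝ) := by
    rw [Real.one_le_sqrt]
    exact_mod_cast Fin.pos_iff_nonempty.mpr hne
  set M : ℝ := max (1 / Real.sqrt δ) (Real.sqrt (N : ℝ)) with hM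
  have hMN : Real.sqrt (N : ℝ) ≤ M := le_max_right _ _
  have hM1 : 1 ≤ M := hN.trans hMN
  have hκM : 1 ≤ κ ^ 2 * M := one_le_mul_of_one_le_of_one_le (one_le_pow₀ hκ1) hM1
  -- The factor `κ²` gives both `k ≥ κ√N` and `k² ≥ κ⁴M² ≥ κ³/δ`, which brings the error `κ³/(4k²)`
  -- below `δ`.
  set k : ℕ := ⌈κ ^ 2 * M⌉₊ with hk
  have hk1 : κ ^ 2 * M ≤ k := Nat.le_ceil _
  have hk2 : (k : ℝ) ≤ 2 * (κ ^ 2 * M) := by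
    have := Nat.ceil_lt_add_one (show 0 ≤ κ ^ 2 * M by linarith)
    linarith
  have hkN : κ * Real.sqrt (Fintype.card (Fin N)) ≤ k := by
    rw [Fintype.card_fin]
    refine le_trans ?_ hk1
    gcongr
    nlinarith
  obtain ⟨L, hlen, hloc, herr⟩ := GraphLocal.exists_local_simulation hH hev hG hκ hkN z
  refine ⟨L, ?_, hloc, herr.trans ?_⟩
  · rw [hlen]
    push_cast
    nlinarith
  · have hδM : 1 ≤ δ * M ^ 2 := by
      have h1 : (1 / Real.sqrt δ) ^ 2 ≤ M ^ 2 := by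
        gcongr
        exact le_max_left _ _
      rw [div_pow, Real.sq_sqrt hδ.le, one_pow, div_le_iff₀ hδ] at h1
      linarith
    have hk0 : (0 : ℝ) < k := by linarith
    rw [div_le_iff₀ (by positivity)]
    have h2 : (κ ^ 2 * M) ^ 2 ≤ (k : ℝ) ^ 2 := by gcongr
    calc κ ^ 3 ≤ κ ^ 4 := pow_le_pow_right₀ hκ1 (by norm_num)
      _ ≤ κ ^ 4 * (δ * M ^ 2) := le_mul_of_one_le_right (by positivity) hδM
      _ = δ * (κ ^ 2 * M) ^ 2 := by ring
      _ ≤ δ * (4 * (k : ℝ) ^ 2) := by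
        gcongr
        nlinarith
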